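/- **Model.** Consider a connected simple graph on $n$ anonymous nodes. At each node $v$ the incident edges carry distinct port numbers $0,\dots,\deg(v)-1$ (the two ends of an edge are numbered independently), and $v$ has a capacity $c(v)\in\mathbb{N}$ (possibly $0$). There are $k$ robots with distinct IDs in $\mathbb N$, placed arbitrarily on the nodes, and $\sum_v c(v)\ge k$. One robot is the *shepherd*; it is never Byzantine, and every robot can tell whether a co-located robot is the shepherd. All robots start at the same time, and time proceeds in synchronous rounds. In each round every robot perceives the degree and capacity of its node and the port through which it has just entered it (if it moved), shouts one message to all robots at its node together with an ID, and hears the IDs and messages of all robots there (one ID and one message per robot); it then computes with unlimited memory and stays, leaves through a port, or terminates, in which case it remains at its node forever. Non-Byzantine robots show their true IDs and follow a deterministic algorithm. At most $f$ robots are *strong Byzantine*: in every round they may show arbitrary IDs, shout arbitrary messages, and stay or move along an edge arbitrarily. Initially the shepherd knows $k$, $f$ and its ID; every other robot knows only its own ID (and not $n$, $k$ or $f$). *Byzantine dispersion* is solved within $R$ rounds if, after at most $R$ rounds, all non-Byzantine robots have terminated and each node $v$ holds at most $c(v)$ non-Byzantine robots. A *universal exploration sequence* (UXS) for size $n$ is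 a finite sequence of integers $x_1,\dots,x_L$ such that, in every connected port-numbered graph with at most $n$ nodes and from every start node, the following walk visits all nodes: first leave through port $0$; then, in step $i=1,\dots,L$, having entered the current node $u$ through port $p$, leave it through port $(p+x_i)\bmod\deg(u)$. The walk takes $L+1$ rounds. **Theorem 2.** There is a constant $C$ such that the following holds. Let a UXS for every size $n$ be fixed, and let $X(n)$ be the number of rounds of the walk along the UXS for size $n$. Then there is an algorithm which, for all $n$, $k$, $f$ with $f<(k-1)/3$, on every capacitated graph with $n$ nodes, from arbitrary initial positions of the $k$ robots, and for every behaviour of the at most $f$ strong Byzantine robots, solves Byzantine dispersion within $C\,(X(n)+n^3)$ rounds, that is, in $O(X(n)+n^3)$ rounds, where the shepherd knows $k$ and $f$. -/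

import Mathlib

/-- A connected simple graph on `n` nodes. At every node `v` the incident edges carry the distinct
port numbers `0, …, deg v - 1`; the two ends of an edge are numbered independently. -/
structure PortGraph (n : ℕ) where
  graph : SimpleGraph (Fin n)
  connected : graph.Connected
  deg : Fin n → ℕ
  port : ∀ v, Fin (deg v) ≃ graph.neighborSet v

/-- Leaving `v` through port `p`: the node that is reached and the port through which it is
entered; `none` if `v` has no port `p`. -/
def PortGraph.cross {n : ℕ} (G : PortGraph n) (v : Fin n) (p : ℕ) : Option (Fin n × ℕ) :=
  if h : p < G.deg v then
    some ((G.port v ⟨p, h⟩ : Fin n),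
      ((G.port (G.port v ⟨p, h⟩)).symm ⟨v, SimpleGraph.Adj.symm (G.port v ⟨p, h⟩).2⟩ : ℕ))
  else none

/-! ### Universal exploration sequences -/

/-- The nodes visited by a robot that is at node `a.1`, which it entered through port `a.2`, and
that follows the integers `x₁, x₂, …`: having entered a node `u` through port `p`, it leaves `u`
through port `(p + xᵢ) mod deg u`. (At an isolated node the robot stays.) -/
def PortGraph.visits {n : ℕ} (G : PortGraph n) : List ℤ → Fin n × ℕ → List (Fin n)
  | [], a => [a.1]
  | x :: xs, a =>
      a.1 :: G.visits xs ((G.cross a.1 (((a.2 : ℤ) + x) % (G.deg a.1 : ℤ)).toNat).getD (a.1, 0))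

/-- `x` is a universal exploration sequence for size `n`: in every connected port-numbered graph
with at most `n` nodes, and from every start node, a robot which first leaves through port `0` and
then follows `x` visits all nodes. (Leaving through port `0` is following the integer `0` after a
fictitious entry through port `0`.) -/
def IsUXS (n : ℕ) (x : List ℤ) : Prop :=
  ∀ m ≤ n, ∀ (G : PortGraph m) (start v : Fin m), v ∈ G.visits (0 :: x) (start, 0)

/-- Number of rounds of the exploration that follows `x`: the first move and one per entry. -/
def uxsRounds (x : List ℤ) : ℕ := x.length + 1

/-! Universal exploration sequences exist for every size. -/

theorem PortGraph.mem_visits_append_left {n : ℕ} (G : PortGraph n) (x y : List ℤ) :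
    ∀ (a : Fin n × ℕ) (v : Fin n), v ∈ G.visits x a → v ∈ G.visits (x ++ y) a := by
  induction x with
  | nil => intro a v h; cases y <;> simp_all [visits]
  | cons z x ih =>
    intro a v h
    simp only [visits, List.cons_append, List.mem_cons] at h ⊢
    exact h.imp id (ih _ _)

theorem PortGraph.mem_visits_append_right {n : ℕ} (G : PortGraph n) (x : List ℤ) :
    ∀ a : Fin n × ℕ, ∃ b : Fin n × ℕ, ∀ y v, v ∈ G.visits y b → v ∈ G.visits (x ++ y) a := by
  induction x with
  | nil => exact fun a => ⟨a, fun y v h => h⟩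
  | cons z x ih =>
    intro a
    obtain ⟨b, hb⟩ := ih ((G.cross a.1 (((a.2 : ℤ) + z) % (G.deg a.1 : ℤ)).toNat).getD (a.1, 0))
    refine ⟨b, fun y v h => ?_⟩
    simp only [visits, List.cons_append, List.mem_cons]
    exact Or.inr (hb y v h)

theorem PortGraph.exists_mem_visits {n : ℕ} (G : PortGraph n) (b : Fin n × ℕ) (v : Fin n) :
    ∃ y, v ∈ G.visits y b := by
  obtain ⟨u, p⟩ := b
  obtain ⟨w⟩ := G.connected.preconnected u v
  induction w generalizing p with
  | nil => exact ⟨[], by simp [visits]⟩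
  | @cons u u' v h w ih =>
    obtain ⟨i, hi⟩ := (G.port u).surjective ⟨u', h⟩
    have hc : ∃ q, G.cross u i = some (u', q) := by
      have hp : (G.port u ⟨i, i.2⟩ : Fin n) = u' := by rw [Fin.eta, hi]
      rw [cross, dif_pos i.2]
      exact ⟨_, congrArg some (Prod.ext hp rfl)⟩
    obtain ⟨q, hq⟩ := hc
    obtain ⟨y, hy⟩ := ih q
    refine ⟨((i : ℕ) - p : ℤ) :: y, ?_⟩
    have hm : (((p : ℤ) + (((i : ℕ) : ℤ) - p)) % (G.deg u : ℤ)).toNat = i := by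
      rw [add_sub_cancel, Int.emod_eq_of_lt (by positivity) (by exact_mod_cast i.2)]
      simp
    simp only [visits, List.mem_cons, hm, hq, Option.getD_some]
    exact Or.inr hy

instance PortGraph.finite (n : ℕ) : Finite (PortGraph n) := by
  refine Finite.of_surjective
    (α := Σ g : {g : SimpleGraph (Fin n) // g.Connected}, Σ d : Fin n → Fin (n + 1),
      ∀ v, Fin (d v) ≃ g.1.neighborSet v)
    (fun x => ⟨x.1.1, x.1.2, fun v => x.2.1 v, x.2.2⟩) fun G => ?_
  have hd : ∀ v, G.deg v < n + 1 := fun v => Nat.lt_succ_of_le <| by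
    have := Fintype.card_le_of_injective (fun i => (G.port v i : Fin n))
      (Subtype.val_injective.comp (G.port v).injective)
    simpa using this
  exact ⟨⟨⟨G.graph, G.connected⟩, fun v => ⟨G.deg v, hd v⟩, G.port⟩, rfl⟩

theorem exists_isUXS (n : ℕ) : ∃ x, IsUXS n x := by
  classical
  have key : ∀ s : Finset (Σ m : Fin (n + 1), PortGraph m × Fin m × Fin m),
      ∃ x, ∀ a ∈ s, a.2.2.2 ∈ a.2.1.visits (0 :: x) (a.2.2.1, 0) := by
    intro s
    induction s using Finset.induction_on with
    | empty => exact ⟨[], by simp⟩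
    | insert a s _ ih =>
      obtain ⟨x, hx⟩ := ih
      obtain ⟨b, hb⟩ := a.2.1.mem_visits_append_right (0 :: x) (a.2.2.1, 0)
      obtain ⟨y, hy⟩ := a.2.1.exists_mem_visits b a.2.2.2
      refine ⟨x ++ y, fun c hc => ?_⟩
      rcases Finset.mem_insert.1 hc with rfl | hc
      · exact hb y _ hy
      · exact c.2.1.mem_visits_append_left (0 :: x) y _ _ (hx c hc)
  have := Fintype.ofFinite (Σ m : Fin (n + 1), PortGraph m × Fin m × Fin m)
  obtain ⟨x, hx⟩ := key Finset.univ
  exact ⟨x, fun m hm G s v => hx ⟨⟨m, Nat.lt_succ_of_le hm⟩, G, s, v⟩ (Finset.mem_univ _)⟩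

/-! ### Robots and algorithms -/

/-- What a robot perceives of its node: the degree, the capacity, and the port through which it
entered in the preceding round (`none` if it did not move). -/
structure LocalView where
  degree : ℕ
  capacity : ℕ
  entry : Option ℕ

/-- What a robot perceives of a co-located robot: the ID it claims, whether it is the shepherd, and
the message it shouts (`none` for a silent robot, in particular for a terminated one). -/
structure Sighting (Msg : Type) where
  label : ℕ
  isShepherd : Bool
  msg : Option Msg

/-- The decision of a robot at the end of the computation of a round: to go on with a new memory
state, staying at the node (`none`) or leaving through a port (`some p`), or to terminate. -/
inductive Decision (State : Type) where
  | go (s : State) (port : Option ℕ) : Decision State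
  | terminate : Decision State

/-- A deterministic distributed algorithm for robots with unlimited memory. Initially the shepherd
knows `k`, `f` and its own ID, and every other robot knows its own ID only. In each round a robot
shouts a message to all co-located robots, and then makes its decision from its memory, its view of
the node and the multiset of its sightings of the co-located robots. -/
structure Algorithm where
  Msg : Type
  State : Type
  initShepherd : (k f id : ℕ) → State
  initOther : (id : ℕ) → State
  shout : State → LocalView → Msg
  step : State → LocalView → Multiset (Sighting Msg) → Decision State

/-- An input with `k` robots on a capacitated graph of `n` nodes: capacities, IDs, initial
positions, the shepherd and the set of Byzantine robots. -/
structure Instance (n k : ℕ) where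
  G : PortGraph n
  cap : Fin n → ℕ
  id : Fin k → ℕ
  start : Fin k → Fin n
  shepherd : Fin k
  byz : Finset (Fin k)

/-- The instances with at most `f` Byzantine robots: the IDs are distinct, the shepherd is not
Byzantine, and the total capacity is at least the number of robots. -/
structure Instance.Valid {n k : ℕ} (I : Instance n k) (f : ℕ) : Prop where
  id_injective : Function.Injective I.id
  shepherd_honest : I.shepherd ∉ I.byz
  card_byz : I.byz.card ≤ f
  total_cap : k ≤ ∑ v, I.cap v

/-- The history of all robots; time `t` is the beginning of round `t`, counted from `0`. For robot
`i` at time `t`: its node, the port through which it has just entered, its memory state (`none` once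
it has terminated; meaningless for Byzantine robots), and the ID and message it shows to the
co-located robots in round `t`. -/
structure Trace (n k : ℕ) (A : Algorithm) where
  pos : ℕ → Fin k → Fin n
  entry : ℕ → Fin k → Option ℕ
  state : ℕ → Fin k → Option A.State
  label : ℕ → Fin k → ℕ
  msg : ℕ → Fin k → Option A.Msg

namespace Trace

variable {n k : ℕ} {A : Algorithm}

def view (I : Instance n k) (τ : Trace n k A) (t : ℕ) (i : Fin k) : LocalView where
  degree := I.G.deg (τ.pos t i)
  capacity := I.cap (τ.pos t i)
  entry := τ.entry t i

/-- The sightings that robot `i` makes in round `t` of the other robots at its node. -/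
def heard (I : Instance n k) (τ : Trace n k A) (t : ℕ) (i : Fin k) :
    Multiset (Sighting A.Msg) :=
  (Finset.univ.filter fun j => j ≠ i ∧ τ.pos t j = τ.pos t i).val.map fun j =>
    ⟨τ.label t j, decide (j = I.shepherd), τ.msg t j⟩

/-- State, node and entry port after a decision taken at node `v`. -/
def outcome {S : Type} (G : PortGraph n) (v : Fin n) :
    Decision S → Option S × Fin n × Option ℕ
  | .terminate => (none, v, none)
  | .go s none => (some s, v, none)
  | .go s (some p) =>
      match G.cross v p with
      | none => (some s, v, none)
      | some (w, q) => (some s, w, some q)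

/-- State, node and entry port at time `t + 1` of a robot `i` that follows the algorithm; a
terminated robot stays where it is. -/
def next (I : Instance n k) (τ : Trace n k A) (t : ℕ) (i : Fin k) :
    Option A.State × Fin n × Option ℕ :=
  match τ.state t i with
  | none => (none, τ.pos t i, none)
  | some s => outcome I.G (τ.pos t i) (A.step s (τ.view I t i) (τ.heard I t i))

/-- `τ` is a possible execution of `A` on `I`, where `A` is told the bound `f`: the other robots
follow the algorithm, show their true IDs and shout what the algorithm says, while the Byzantine
robots show arbitrary IDs and messages and stay or move along edges arbitrarily. -/
structure IsExecution (I : Instance n k) (f : ℕ) (τ : Trace n k A) : Prop where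
  pos_zero : ∀ i, τ.pos 0 i = I.start i
  entry_zero : ∀ i ∉ I.byz, τ.entry 0 i = none
  state_zero : ∀ i ∉ I.byz, τ.state 0 i =
    some (if i = I.shepherd then A.initShepherd k f (I.id i) else A.initOther (I.id i))
  label_eq : ∀ t, ∀ i ∉ I.byz, τ.label t i = I.id i
  msg_eq : ∀ t, ∀ i ∉ I.byz, τ.msg t i = (τ.state t i).map fun s => A.shout s (τ.view I t i)
  follow : ∀ t, ∀ i ∉ I.byz,
    (τ.state (t + 1) i, τ.pos (t + 1) i, τ.entry (t + 1) i) = τ.next I t i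
  byz_move : ∀ t, ∀ i ∈ I.byz,
    τ.pos (t + 1) i = τ.pos t i ∨ I.G.graph.Adj (τ.pos t i) (τ.pos (t + 1) i)

/-- Byzantine dispersion is achieved at time `T`, i.e. after `T` rounds: all non-Byzantine robots
have terminated, and every node holds at most as many of them as its capacity. -/
def DispersedAt (I : Instance n k) (τ : Trace n k A) (T : ℕ) : Prop :=
  (∀ i ∉ I.byz, τ.state T i = none) ∧
    ∀ v, (Finset.univ.filter fun i => i ∉ I.byz ∧ τ.pos T i = v).card ≤ I.cap v

end Trace

/-- The algorithm `A`, whose shepherd is told `k` and `f`, solves Byzantine dispersion of `k`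
robots, at most `f` of them Byzantine, on every capacitated graph with `n` nodes within `R` rounds,
whatever the initial positions and whatever the Byzantine robots do. -/
def Algorithm.SolvesByzantineDispersion (A : Algorithm) (n k f R : ℕ) : Prop :=
  ∀ I : Instance n k, I.Valid f → ∀ τ : Trace n k A, τ.IsExecution I f →
    ∃ T ≤ R, τ.DispersedAt I T

/-! The shepherd cannot be impersonated, so honest robots stay put until it gives them an order, and
they obey nobody else. It does not know n, so it gathers along exploration sequences with budgets 1,
2, 4, …; the first budget that covers X(n) is exhausted after O(X(n)) rounds (`exists_budget_uxs`,
`Gathering.exists_pos_eq`). It stops once k - f - 1 other robots are with it. This must happen when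
all honest ones have been met, and since 3f + 2 ≤ k, at least f + 1 of the robots present are then
honest followers, even if Byzantine robots stand in for honest ones not yet found
(`exists_exploring`, `Gathering.exploring`).

Such a herd is a movable token that cannot be counterfeited, because Byzantine robots alone produce
at most f claims of membership (`herdHere_iff`). With a token an anonymous graph can be mapped: to
decide whether a port leads to a known node, the herd is parked behind it and the shepherd walks
once around a closed tour through the known nodes. If it does not meet the herd, the node is new and
the tour is extended by a detour of two steps (`Exploring.check`). Hence the tour has fewer than 2n
steps, at most n ports are checked before each of them and at the end, and a check costs O(n)
rounds: O(n^3) in total (`Exploring.exists_assembled`). When the tour is completed, the known nodes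
are closed under leaving through ports, so by connectivity they are all nodes, and every remaining
follower has been picked up on the way (`Exploring.finish`).

Finally the shepherd lists the IDs that it hears: one per other robot, hence fewer than k, among
them those of all followers. It leads the herd along the tour once more and assigns to each node,
when it is discovered, as many listed IDs as it has places. False or repeated IDs only waste places,
and the total capacity has room for the whole list and the shepherd (`Settling.advance`,
`Settling.finish`). -/

/-! ### Walks along port numbers -/

namespace PortGraph

variable {n : ℕ} (G : PortGraph n)

/-- The node and the entry port of a robot that stays at `v` or leaves it through a port; it stays
if there is no such port. -/
def leave (v : Fin n) (p : Option ℕ) : Fin n × Option ℕ :=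
  (p.bind (G.cross v)).elim (v, none) fun a => (a.1, some a.2)

/-- The node reached from `v` through port `p`. -/
def next (v : Fin n) (p : ℕ) : Fin n := (G.leave v (some p)).1

/-- The end of the walk from `v` along marked ports. -/
def dest (v : Fin n) : List (ℕ × Bool) → Fin n
  | [] => v
  | a :: l => dest (G.next v a.1) l

/-- The nodes from which a step of the walk from `v` along marked ports is taken. -/
def sources (v : Fin n) : List (ℕ × Bool) → List (Fin n)
  | [] => []
  | a :: l => v :: sources (G.next v a.1) l

/-- The nodes that the walk from `v` along marked ports enters by a step marked `true`. -/
def discovered (v : Fin n) : List (ℕ × Bool) → List (Fin n)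
  | [] => []
  | a :: l => (if a.2 then [G.next v a.1] else []) ++ discovered (G.next v a.1) l

/-- All nodes of the walk from `v` along marked ports. -/
def nodes (v : Fin n) (l : List (ℕ × Bool)) : List (Fin n) := G.sources v l ++ [G.dest v l]

theorem leave_some_of_cross {v w : Fin n} {p q : ℕ} (h : G.cross v p = some (w, q)) :
    G.leave v (some p) = (w, some q) := by
  simp [leave, h]

theorem dest_append (v : Fin n) (l₁ l₂ : List (ℕ × Bool)) :
    G.dest v (l₁ ++ l₂) = G.dest (G.dest v l₁) l₂ := by
  induction l₁ generalizing v with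
  | nil => rfl
  | cons a l ih => exact ih _

theorem sources_append (v : Fin n) (l₁ l₂ : List (ℕ × Bool)) :
    G.sources v (l₁ ++ l₂) = G.sources v l₁ ++ G.sources (G.dest v l₁) l₂ := by
  induction l₁ generalizing v with
  | nil => rfl
  | cons a l ih => exact congrArg _ (ih _)

theorem discovered_append (v : Fin n) (l₁ l₂ : List (ℕ × Bool)) :
    G.discovered v (l₁ ++ l₂) = G.discovered v l₁ ++ G.discovered (G.dest v l₁) l₂ := by
  induction l₁ generalizing v with
  | nil => rfl
  | cons a l ih => simp [discovered, dest, ih]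

theorem start_mem_nodes (v : Fin n) (l : List (ℕ × Bool)) : v ∈ G.nodes v l := by
  cases l <;> simp [nodes, sources, dest]

theorem dest_mem_nodes (v : Fin n) (l : List (ℕ × Bool)) : G.dest v l ∈ G.nodes v l := by
  simp [nodes]

theorem nodes_cons (v : Fin n) (a : ℕ × Bool) (l : List (ℕ × Bool)) :
    G.nodes v (a :: l) = v :: G.nodes (G.next v a.1) l := rfl

theorem mem_nodes_append (v x : Fin n) (l₁ l₂ : List (ℕ × Bool)) :
    x ∈ G.nodes v (l₁ ++ l₂) ↔ x ∈ G.nodes v l₁ ∨ x ∈ G.nodes (G.dest v l₁) l₂ := by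
  have := G.start_mem_nodes (G.dest v l₁) l₂
  simp only [nodes, sources_append, dest_append, List.mem_append, List.mem_singleton] at this ⊢
  constructor
  · tauto
  · rintro ((h | rfl) | h) <;> tauto

theorem exists_cross {v : Fin n} {p : ℕ} (h : p < G.deg v) :
    ∃ w q, G.cross v p = some (w, q) ∧ q < G.deg w := by
  rw [cross, dif_pos h]
  exact ⟨_, _, rfl, Fin.is_lt _⟩

theorem next_of_cross {v w : Fin n} {p q : ℕ} (h : G.cross v p = some (w, q)) :
    G.next v p = w := by
  simp [next, G.leave_some_of_cross h]

/-- The entry port is the way back, which makes checking a port, and a detour of the tour,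
reversible. -/
theorem next_back {v w : Fin n} {p q : ℕ} (h : G.cross v p = some (w, q)) : G.next w q = v := by
  unfold cross at h
  split_ifs at h with hp
  simp only [Option.some.injEq, Prod.mk.injEq] at h
  obtain ⟨rfl, rfl⟩ := h
  simp [next, leave, cross]

theorem exists_next_eq {v w : Fin n} (h : G.graph.Adj v w) : ∃ p < G.deg v, G.next v p = w := by
  obtain ⟨i, hi⟩ := (G.port v).surjective ⟨w, h⟩
  refine ⟨i, i.2, ?_⟩
  simp [next, leave, cross, hi]

theorem deg_le (v : Fin n) : G.deg v ≤ n := by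
  have := Fintype.card_le_of_injective (fun i => (G.port v i : Fin n))
    (Subtype.val_injective.comp (G.port v).injective)
  simpa using this

/-- A nonempty set of nodes that is closed under leaving through ports contains all nodes. -/
theorem mem_of_closed {S : Set (Fin n)} {r : Fin n} (hr : r ∈ S)
    (hS : ∀ x ∈ S, ∀ p < G.deg x, G.next x p ∈ S) (v : Fin n) : v ∈ S := by
  obtain ⟨w⟩ := G.connected.preconnected r v
  induction w with
  | nil => exact hr
  | cons h _ ih =>
    obtain ⟨p, hp, rfl⟩ := G.exists_next_eq h
    exact ih (hS _ hr p hp)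

theorem length_visits (x : List ℤ) : ∀ a, (G.visits x a).length = x.length + 1 := by
  induction x with
  | nil => intro a; rfl
  | cons z x ih => intro a; simp [visits, ih]

/-- A robot that follows `x` is at each of the visited nodes at some time. -/
theorem exists_eq_of_mem_visits (v : Fin n) (x : List ℤ) : ∀ b : ℕ → Fin n × ℕ,
    (∀ s < x.length, b (s + 1) = (G.cross (b s).1
      (((b s).2 + x.getD s 0) % (G.deg (b s).1 : ℤ)).toNat).getD ((b s).1, 0)) →
    v ∈ G.visits x (b 0) → ∃ s ≤ x.length, (b s).1 = v := by
  induction x with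
  | nil => intro b _ h; exact ⟨0, le_rfl, by simpa [visits, eq_comm] using h⟩
  | cons z x ih =>
    intro b hb h
    simp only [visits, List.mem_cons] at h
    rcases h with rfl | h
    · exact ⟨0, Nat.zero_le _, rfl⟩
    · obtain ⟨s, hs, e⟩ := ih (fun s => b (s + 1))
        (fun s hs => by simpa using hb (s + 1) (by simpa using hs))
        (by have := hb 0 (by simp); simp only [List.getD_cons_zero] at this; rw [this]; exact h)
      exact ⟨s + 1, by simpa using hs, e⟩

end PortGraph

/-! ### Exploration within a budget -/

theorem IsUXS.mono {m n : ℕ} {x : List ℤ} (h : IsUXS n x) (hmn : m ≤ n) : IsUXS m x :=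
  fun l hl => h l (hl.trans hmn)

theorem exists_portGraph (n : ℕ) (hn : 0 < n) : Nonempty (PortGraph n) := by
  classical
  have : Nonempty (Fin n) := ⟨⟨0, hn⟩⟩
  exact ⟨⟨⊤, SimpleGraph.connected_top,
    fun v => Fintype.card ((⊤ : SimpleGraph (Fin n)).neighborSet v),
    fun v => (Fintype.equivFin _).symm⟩⟩

/-- A walk is at no more nodes than its number of rounds plus one. Consequently only finitely many
sizes fit into a given budget. -/
theorem IsUXS.le_rounds {n : ℕ} {x : List ℤ} (h : IsUXS n x) : n ≤ uxsRounds x + 1 := by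
  rcases Nat.eq_zero_or_pos n with rfl | hn
  · exact Nat.zero_le _
  obtain ⟨G⟩ := exists_portGraph n hn
  have h1 : (Finset.univ : Finset (Fin n)) ⊆ (G.visits (0 :: x) (⟨0, hn⟩, 0)).toFinset :=
    fun v _ => List.mem_toFinset.2 (h n le_rfl G _ v)
  have h2 := (Finset.card_le_card h1).trans (List.toFinset_card_le _)
  simpa [G.length_visits, uxsRounds] using h2

/-- Among given exploration sequences, one that fits into a budget of `b` rounds serves all sizes
whose sequences fit into this budget. -/
theorem exists_budget_uxs {U : ℕ → List ℤ} (hU : ∀ n, IsUXS n (U n)) (b : ℕ) :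
    ∃ x : List ℤ, ∀ n, uxsRounds (U n) ≤ b → IsUXS n x ∧ uxsRounds x ≤ b := by
  classical
  by_cases hb : ∃ n, uxsRounds (U n) ≤ b
  · have hbound : ∀ n, uxsRounds (U n) ≤ b → n ≤ b + 1 :=
      fun n hn => ((hU n).le_rounds).trans (by omega)
    obtain ⟨n₀, hn₀⟩ := hb
    have hmem : n₀ ≤ b + 1 := hbound n₀ hn₀
    -- The sequence for the largest size that fits serves all smaller sizes; no monotonicity of the
    -- number of rounds is needed.
    have hspec : uxsRounds (U (Nat.findGreatest (fun n => uxsRounds (U n) ≤ b) (b + 1))) ≤ b :=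
      Nat.findGreatest_spec (P := fun n => uxsRounds (U n) ≤ b) hmem hn₀
    exact ⟨_, fun n hn => ⟨(hU _).mono (Nat.le_findGreatest (hbound n hn) hn), hspec⟩⟩
  · push Not at hb
    exact ⟨[], fun n hn => absurd hn (not_le.2 (hb n))⟩

/-! ### The algorithm -/

namespace Herding

/-- A follower reports whether it has joined the herd, and the shepherd can give an order to all
robots at its node: those whose IDs are listed terminate, the others join the herd and leave through
the given port (or stay). A shepherd that reports gives no order. -/
inductive Message where
  | report (joined : Bool)
  | order (settlers : List ℕ) (port : Option ℕ)

/-- The memory of a robot. The shepherd first gathers a herd. Then it explores the graph: it stands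
at a node of a known closed tour `A ++ B`, whose part `B` is done, and checks the ports of this node.
To check port `p`, it leads the herd through `p`, leaves it `away`, scans the tour for it, and leads
it `back`. Finally it leads the herd along the tour and lets the robots settle. In a tour, the steps
that lead to newly discovered nodes are marked `true`. -/
inductive Memory where
  | follower (id : ℕ) (joined : Bool)
  | gather (k f t : ℕ)
  | base (f : ℕ) (A B : List (ℕ × Bool)) (p : ℕ)
  | away (f : ℕ) (A B : List (ℕ × Bool)) (p : ℕ)
  | scan (f : ℕ) (A B : List (ℕ × Bool)) (p q : ℕ) (rest : List (ℕ × Bool)) (found : Prop)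
  | back (f : ℕ) (A B : List (ℕ × Bool)) (p q : ℕ) (found : Prop)
  | settle (L : List ℕ) (T : List (ℕ × Bool)) (new : Bool)

/-- The port used in round `t` of the gathering: with the sequences `W j` for budgets `2 ^ j`, the
exploration along `W j` begins in round `2 ^ j - 1`. -/
def gatherPort (W : ℕ → List ℤ) (t : ℕ) (ν : LocalView) : ℕ :=
  let j := Nat.log 2 (t + 1)
  if t + 1 = 2 ^ j then 0
  else (((ν.entry.getD 0 : ℕ) + (W j).getD (t - 2 ^ j) 0 : ℤ) % (ν.degree : ℤ)).toNat

/-- The port through which the shepherd is going to leave. -/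
def Memory.port (W : ℕ → List ℤ) : Memory → LocalView → Option ℕ
  | follower _ _, _ => none
  | gather _ _ t, ν => some (gatherPort W t ν)
  | base _ A _ p, ν => if p < ν.degree then some p else A.head?.map Prod.fst
  | away _ _ _ _, ν => ν.entry
  | scan _ _ _ p _ rest _, _ => some (rest.head?.elim p Prod.fst)
  | back _ _ _ _ q _, _ => some q
  | settle _ T _, _ => T.head?.map Prod.fst

/-- The message shouted by a robot. -/
def Memory.shout (W : ℕ → List ℤ) : Memory → LocalView → Message
  | follower _ b, _ => .report b
  -- While separated from the herd the shepherd gives no orders, so neither the parked herd nor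
  -- robots met on the scan move.
  | away _ _ _ _, _ => .report false
  | scan _ _ _ _ _ _ _, _ => .report false
  | settle L T new, ν =>
      .order (if new then L.take ν.capacity else []) ((settle L T new).port W ν)
  | s, ν => .order [] (s.port W ν)

open Classical in
/-- More than `f` robots here claim to be in the herd. -/
noncomputable def HerdHere (f : ℕ) (H : Multiset (Sighting Message)) : Prop :=
  f < H.countP fun s => s.msg = some (.report true)

open Classical in
/-- The new memory of the shepherd. -/
noncomputable def Memory.update : Memory → LocalView → Multiset (Sighting Message) → Memory
  | follower i b, _, _ => follower i b
  -- Up to f robots may never show up, and the shepherd does not hear itself.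
  | gather k f t, _, H => if k ≤ H.card + f + 1 then base f [] [] 0 else gather k f (t + 1)
  | base f A B p, ν, H =>
      if p < ν.degree then away f A B p
      else match A with
        | a :: A => base f A (B ++ [a]) 0
        | [] => settle (H.map Sighting.label).toList B true
  -- The scan starts at the present base, hence the rotation `A ++ B` of the tour `B ++ A`.
  | away f A B p, ν, _ => scan f A B p (ν.entry.getD 0) (A ++ B) False
  | scan f A B p q rest found, _, H =>
      match rest with
        | _ :: rest => scan f A B p q rest (found ∨ HerdHere f H)
        | [] => back f A B p q (found ∨ HerdHere f H)
  | back f A B p q found, _, _ =>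
      base f (if found then A else (p, true) :: (q, false) :: A) B (p + 1)
  | settle L T new, ν, _ =>
      settle (if new then L.drop ν.capacity else L) T.tail (T.head?.elim false Prod.snd)

/-- The shepherd terminates when all remaining robots and itself fit into the present node. -/
def Memory.Done : Memory → LocalView → Prop
  -- The strict inequality reserves a place for the shepherd.
  | settle L _ new, ν => new = true ∧ L.length < ν.capacity
  | _, _ => False

open Classical in
/-- The decision of a follower: to obey the order of the shepherd, if there is one. -/
noncomputable def obey (i : ℕ) (b : Bool) (H : Multiset (Sighting Message)) : Decision Memory :=
  if h : ∃ c : List ℕ × Option ℕ, ∃ s ∈ H, s.isShepherd = true ∧ s.msg = some (.order c.1 c.2) then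
    if i ∈ h.choose.1 then .terminate else .go (.follower i true) h.choose.2
  else .go (.follower i b) none

open Classical in
/-- The decision of a robot. -/
noncomputable def decision (W : ℕ → List ℤ) :
    Memory → LocalView → Multiset (Sighting Message) → Decision Memory
  | .follower i b, _, H => obey i b H
  | s, ν, H => if s.Done ν then .terminate else .go (s.update ν H) (s.port W ν)

/-- The algorithm of the herding shepherd. -/
noncomputable abbrev algorithm (W : ℕ → List ℤ) : Algorithm where
  Msg := Message
  State := Memory
  initShepherd k f _ := .gather k f 0
  initOther i := .follower i false
  shout s ν := s.shout W ν
  step := decision W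

/-! ### Single rounds -/

variable {n k f : ℕ} {I : Instance n k} {W : ℕ → List ℤ} {τ : Trace n k (algorithm W)}

theorem outcome_go {S : Type} (G : PortGraph n) (v : Fin n) (s : S) (p : Option ℕ) :
    Trace.outcome G v (.go s p) = (some s, G.leave v p) := by
  cases p with
  | none => rfl
  | some p =>
    simp only [Trace.outcome, PortGraph.leave, Option.bind_some]
    cases G.cross v p <;> rfl

/-- The shepherd has memory `s` at time `t`, and its node and entry port are given by `a`. -/
def ShepherdAt (I : Instance n k) (τ : Trace n k (algorithm W)) (t : ℕ) (s : Memory)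
    (a : Fin n × Option ℕ) : Prop :=
  τ.state t I.shepherd = some s ∧ (τ.pos t I.shepherd, τ.entry t I.shepherd) = a

/-- The view of a robot whose node and entry port are given by `a`. -/
def viewAt (I : Instance n k) (a : Fin n × Option ℕ) : LocalView := ⟨I.G.deg a.1, I.cap a.1, a.2⟩

theorem ShepherdAt.view {t : ℕ} {s : Memory} {a : Fin n × Option ℕ} (h : ShepherdAt I τ t s a) :
    τ.view I t I.shepherd = viewAt I a := by
  rw [← h.2]; rfl

theorem ShepherdAt.msg (hI : I.Valid f) (hτ : τ.IsExecution I f) {t : ℕ} {s : Memory}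
    {a : Fin n × Option ℕ} (h : ShepherdAt I τ t s a) :
    τ.msg t I.shepherd = some (s.shout W (viewAt I a)) := by
  rw [hτ.msg_eq t _ hI.shepherd_honest, h.1, h.view]; rfl

theorem ShepherdAt.next (hI : I.Valid f) (hτ : τ.IsExecution I f) {t : ℕ} {s : Memory}
    {a : Fin n × Option ℕ} (h : ShepherdAt I τ t s a) (hs : ∀ i b, s ≠ .follower i b)
    (hd : ¬ s.Done (viewAt I a)) :
    ShepherdAt I τ (t + 1) (s.update (viewAt I a) (τ.heard I t I.shepherd))
      (I.G.leave a.1 (s.port W (viewAt I a))) := by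
  have h1 := hτ.follow t _ hI.shepherd_honest
  have h2 : decision W s (viewAt I a) (τ.heard I t I.shepherd) =
      .go (s.update (viewAt I a) (τ.heard I t I.shepherd)) (s.port W (viewAt I a)) := by
    cases s <;> first | exact absurd rfl (hs _ _) | exact if_neg hd
  have h3 : τ.next I t I.shepherd = Trace.outcome I.G a.1
      (.go (s.update (viewAt I a) (τ.heard I t I.shepherd)) (s.port W (viewAt I a))) := by
    have h0 := h.1
    simp only [Trace.next, h0, h.view]
    rw [← h2, ← h.2]
  rw [h3, outcome_go] at h1
  exact ⟨congrArg Prod.fst h1, congrArg Prod.snd h1⟩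

theorem mem_heard {t : ℕ} {i j : Fin k} (hij : j ≠ i) (h : τ.pos t j = τ.pos t i) :
    (⟨τ.label t j, decide (j = I.shepherd), τ.msg t j⟩ : Sighting Message) ∈ τ.heard I t i :=
  Multiset.mem_map.2 ⟨j, by simp [hij, h], rfl⟩

/-- The shepherd flag is truthful even for Byzantine robots, so every order obeyed is genuine. -/
theorem of_mem_heard {t : ℕ} {i : Fin k} {s : Sighting Message} (h : s ∈ τ.heard I t i)
    (hs : s.isShepherd = true) :
    τ.pos t I.shepherd = τ.pos t i ∧ s.msg = τ.msg t I.shepherd := by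
  obtain ⟨j, hj, rfl⟩ := Multiset.mem_map.1 h
  have hj' : j = I.shepherd := by simpa using hs
  subst hj'
  have : I.shepherd ≠ i ∧ τ.pos t I.shepherd = τ.pos t i := by simpa using hj
  exact ⟨this.2, rfl⟩

/-- A follower that hears an order obeys it. -/
theorem follower_obeys (hτ : τ.IsExecution I f) {t : ℕ} {i : Fin k} (hi : i ∉ I.byz)
    (his : i ≠ I.shepherd) {b : Bool} (hb : τ.state t i = some (.follower (I.id i) b))
    (hpos : τ.pos t i = τ.pos t I.shepherd) {S : List ℕ} {p : Option ℕ}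
    (hmsg : τ.msg t I.shepherd = some (Message.order S p)) :
    (I.id i ∈ S → τ.state (t + 1) i = none ∧ τ.pos (t + 1) i = τ.pos t i) ∧
    (I.id i ∉ S → τ.state (t + 1) i = some (.follower (I.id i) true) ∧
      τ.pos (t + 1) i = (I.G.leave (τ.pos t i) p).1) := by
  have h1 := hτ.follow t i hi
  have hex : ∃ c : List ℕ × Option ℕ, ∃ s ∈ τ.heard I t i,
      s.isShepherd = true ∧ s.msg = some (Message.order c.1 c.2) :=
    ⟨(S, p), _, mem_heard (Ne.symm his) hpos.symm, by simp, hmsg⟩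
  -- There is only one shepherd and it shouts one message, so the choice in `obey` is forced.
  have hc : hex.choose = (S, p) := by
    obtain ⟨s, hs, hs1, hs2⟩ := hex.choose_spec
    rw [(of_mem_heard hs hs1).2, hmsg] at hs2
    simp only [Option.some.injEq, Message.order.injEq] at hs2
    exact Prod.ext hs2.1.symm hs2.2.symm
  have h2 : τ.next I t i = Trace.outcome I.G (τ.pos t i)
      (if I.id i ∈ S then .terminate else .go (.follower (I.id i) true) p) := by
    have h0 := hb
    simp only [Trace.next, h0]
    change Trace.outcome I.G (τ.pos t i) (obey (I.id i) b (τ.heard I t i)) = _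
    rw [obey, dif_pos hex, hc]
  rw [h2] at h1
  refine ⟨fun h => ?_, fun h => ?_⟩
  · rw [if_pos h] at h1
    exact ⟨congrArg Prod.fst h1, congrArg (fun x => x.2.1) h1⟩
  · rw [if_neg h, outcome_go] at h1
    exact ⟨congrArg Prod.fst h1, congrArg (fun x => x.2.1) h1⟩

/-- A follower that hears no order stays as it is. -/
theorem follower_waits (hτ : τ.IsExecution I f) {t : ℕ} {i : Fin k} (hi : i ∉ I.byz) {b : Bool}
    (hb : τ.state t i = some (.follower (I.id i) b))
    (h : τ.pos t i = τ.pos t I.shepherd →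
      ∀ S p, τ.msg t I.shepherd ≠ some (Message.order S p)) :
    τ.state (t + 1) i = some (.follower (I.id i) b) ∧ τ.pos (t + 1) i = τ.pos t i := by
  have h1 := hτ.follow t i hi
  have hex : ¬ ∃ c : List ℕ × Option ℕ, ∃ s ∈ τ.heard I t i,
      s.isShepherd = true ∧ s.msg = some (Message.order c.1 c.2) := by
    rintro ⟨c, s, hs, hs1, hs2⟩
    obtain ⟨h3, h4⟩ := of_mem_heard hs hs1
    exact h h3.symm _ _ (h4 ▸ hs2)
  have h2 : τ.next I t i = Trace.outcome I.G (τ.pos t i) (.go (.follower (I.id i) b) none) := by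
    have h0 := hb
    simp only [Trace.next, h0]
    change Trace.outcome I.G (τ.pos t i) (obey (I.id i) b (τ.heard I t i)) = _
    rw [obey, dif_neg hex]
  rw [h2, outcome_go] at h1
  exact ⟨congrArg Prod.fst h1, congrArg (fun x => x.2.1) h1⟩

/-- A terminated robot stays. -/
theorem terminated_stays (hτ : τ.IsExecution I f) {t : ℕ} {i : Fin k} (hi : i ∉ I.byz)
    (hb : τ.state t i = none) : τ.state (t + 1) i = none ∧ τ.pos (t + 1) i = τ.pos t i := by
  have h1 := hτ.follow t i hi
  rw [Trace.next, hb] at h1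
  exact ⟨congrArg Prod.fst h1, congrArg (fun x => x.2.1) h1⟩

/-! ### The herd -/

/-- The non-Byzantine robots other than the shepherd. -/
def followers (I : Instance n k) : Finset (Fin k) :=
  Finset.univ.filter fun i => i ∉ I.byz ∧ i ≠ I.shepherd

theorem mem_followers {i : Fin k} : i ∈ followers I ↔ i ∉ I.byz ∧ i ≠ I.shepherd := by
  simp [followers]

/-- At time `t`, the followers that have joined the herd are at `u`; the others are where they
started, and not at a node of `D`. -/
def HerdAt (I : Instance n k) (τ : Trace n k (algorithm W)) (t : ℕ) (u : Fin n)
    (D : Set (Fin n)) : Prop :=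
  ∀ i ∈ followers I,
    (τ.state t i = some (.follower (I.id i) true) ∧ τ.pos t i = u) ∨
    (τ.state t i = some (.follower (I.id i) false) ∧ τ.pos t i = I.start i ∧ I.start i ∉ D)

/-- At least `m` followers have joined the herd. -/
def HerdSize (I : Instance n k) (τ : Trace n k (algorithm W)) (t m : ℕ) : Prop :=
  ∃ J ⊆ followers I, m ≤ J.card ∧ ∀ i ∈ J, τ.state t i = some (.follower (I.id i) true)

theorem HerdAt.mono {t : ℕ} {u : Fin n} {D E : Set (Fin n)} (h : HerdAt I τ t u D) (hE : E ⊆ D) :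
    HerdAt I τ t u E :=
  fun i hi => (h i hi).imp id fun h => ⟨h.1, h.2.1, fun h' => h.2.2 (hE h')⟩

/-- All followers at the node of the shepherd obey its order to move. -/
theorem HerdAt.obeys (hI : I.Valid f) (hτ : τ.IsExecution I f) {t : ℕ} {s : Memory}
    {a : Fin n × Option ℕ} {D : Set (Fin n)} (hs : ShepherdAt I τ t s a) (h : HerdAt I τ t a.1 D)
    {p : Option ℕ} (hp : s.shout W (viewAt I a) = .order [] p) {i : Fin k} (hi : i ∈ followers I)
    (hpos : τ.pos t i = a.1) :
    τ.state (t + 1) i = some (.follower (I.id i) true) ∧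
      τ.pos (t + 1) i = (I.G.leave a.1 p).1 := by
  have hi' := mem_followers.1 hi
  have hst : ∃ b, τ.state t i = some (.follower (I.id i) b) := by
    rcases h i hi with h | h
    · exact ⟨_, h.1⟩
    · exact ⟨_, h.1⟩
  obtain ⟨b, hb⟩ := hst
  have ha : τ.pos t I.shepherd = a.1 := congrArg Prod.fst hs.2
  have := (follower_obeys hτ hi'.1 hi'.2 hb (hpos.trans ha.symm)
    ((hs.msg hI hτ).trans (congrArg some hp))).2 (by simp)
  rwa [hpos] at this

/-- The shepherd leads the herd. -/
theorem HerdAt.lead (hI : I.Valid f) (hτ : τ.IsExecution I f) {t : ℕ} {s : Memory}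
    {a : Fin n × Option ℕ} {D : Set (Fin n)} (hs : ShepherdAt I τ t s a) (h : HerdAt I τ t a.1 D)
    {p : Option ℕ} (hp : s.shout W (viewAt I a) = .order [] p) :
    HerdAt I τ (t + 1) (I.G.leave a.1 p).1 (insert a.1 D) := by
  intro i hi
  by_cases hpos : τ.pos t i = a.1
  · exact Or.inl (HerdAt.obeys hI hτ hs h hp hi hpos)
  · rcases h i hi with h1 | ⟨h1, h2, h3⟩
    · exact absurd h1.2 hpos
    · have ha : τ.pos t I.shepherd = a.1 := congrArg Prod.fst hs.2
      have h4 := follower_waits hτ (mem_followers.1 hi).1 h1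
        fun h => absurd (h.trans ha) hpos
      refine Or.inr ⟨h4.1, h4.2.trans h2, ?_⟩
      rintro (h5 | h5)
      · exact hpos (h2.trans h5)
      · exact h3 h5

theorem HerdSize.lead (hI : I.Valid f) (hτ : τ.IsExecution I f) {t m : ℕ} {s : Memory}
    {a : Fin n × Option ℕ} {D : Set (Fin n)} (hs : ShepherdAt I τ t s a) (h : HerdAt I τ t a.1 D)
    {p : Option ℕ} (hp : s.shout W (viewAt I a) = .order [] p) (hm : HerdSize I τ t m) :
    HerdSize I τ (t + 1) m := by
  obtain ⟨J, hJ, hm, hs'⟩ := hm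
  refine ⟨J, hJ, hm, fun i hi => (HerdAt.obeys hI hτ hs h hp (hJ hi) ?_).1⟩
  rcases h i (hJ hi) with h1 | h1
  · exact h1.2
  · have := h1.1.symm.trans (hs' i hi); simp at this

/-- The herd waits for the shepherd. -/
theorem HerdAt.wait (hI : I.Valid f) (hτ : τ.IsExecution I f) {t : ℕ} {s : Memory}
    {a : Fin n × Option ℕ} {u : Fin n} {D : Set (Fin n)} (hs : ShepherdAt I τ t s a)
    (h : HerdAt I τ t u D) {b : Bool} (hb : s.shout W (viewAt I a) = .report b) :
    HerdAt I τ (t + 1) u D := by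
  have hmsg : ∀ S p, τ.msg t I.shepherd ≠ some (Message.order S p) := by
    intro S p; rw [hs.msg hI hτ, hb]; simp
  intro i hi
  rcases h i hi with h1 | h1
  · have h2 := follower_waits hτ (mem_followers.1 hi).1 h1.1 fun _ => hmsg
    exact Or.inl ⟨h2.1, h2.2.trans h1.2⟩
  · have h2 := follower_waits hτ (mem_followers.1 hi).1 h1.1 fun _ => hmsg
    exact Or.inr ⟨h2.1, h2.2.trans h1.2.1, h1.2.2⟩

theorem HerdSize.wait (hI : I.Valid f) (hτ : τ.IsExecution I f) {t m : ℕ} {s : Memory}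
    {a : Fin n × Option ℕ} (hs : ShepherdAt I τ t s a)
    {b : Bool} (hb : s.shout W (viewAt I a) = .report b) (hm : HerdSize I τ t m) :
    HerdSize I τ (t + 1) m := by
  obtain ⟨J, hJ, hm, hs'⟩ := hm
  have hmsg : ∀ S p, τ.msg t I.shepherd ≠ some (Message.order S p) := by
    intro S p; rw [hs.msg hI hτ, hb]; simp
  exact ⟨J, hJ, hm, fun i hi =>
    (follower_waits hτ (mem_followers.1 (hJ hi)).1 (hs' i hi) fun _ => hmsg).1⟩

/-- A herd with more than `f` followers is recognized. -/
theorem herdHere_iff (hI : I.Valid f) (hτ : τ.IsExecution I f) {t : ℕ} {u : Fin n}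
    {D : Set (Fin n)} (h : HerdAt I τ t u D) (hm : HerdSize I τ t (f + 1)) :
    HerdHere f (τ.heard I t I.shepherd) ↔ τ.pos t I.shepherd = u := by
  classical
  have hmsg : ∀ i ∈ followers I, ∀ b, τ.state t i = some (.follower (I.id i) b) →
      τ.msg t i = some (Message.report b) := by
    intro i hi b hb
    rw [hτ.msg_eq t i (mem_followers.1 hi).1, hb]; rfl
  have hcount : (τ.heard I t I.shepherd).countP (fun s => s.msg = some (Message.report true)) =
      (Finset.univ.filter fun j => (j ≠ I.shepherd ∧ τ.pos t j = τ.pos t I.shepherd) ∧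
        τ.msg t j = some (Message.report true)).card := by
    rw [Trace.heard, Multiset.countP_map, ← Finset.filter_filter (fun j => j ≠ I.shepherd ∧ _)]
    rfl
  unfold HerdHere
  constructor
  · intro hf
    by_contra hu
    -- Away from the herd, honest followers report that they have not joined; only Byzantine robots
    -- claim the contrary.
    have hsub : (Finset.univ.filter fun j => (j ≠ I.shepherd ∧ τ.pos t j = τ.pos t I.shepherd) ∧
        τ.msg t j = some (Message.report true)) ⊆ I.byz := by
      intro j hj
      by_contra hjb
      simp only [Finset.mem_filter, Finset.mem_univ, true_and] at hj
      have hjf : j ∈ followers I := mem_followers.2 ⟨hjb, hj.1.1⟩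
      rcases h j hjf with h1 | h1
      · exact hu (hj.1.2.symm.trans h1.2)
      · have := (hmsg j hjf _ h1.1).symm.trans hj.2
        simp at this
    have := (Finset.card_le_card hsub).trans hI.card_byz
    rw [← hcount] at this
    exact absurd hf (not_lt.2 this)
  · intro hu
    obtain ⟨J, hJ, hm, hs'⟩ := hm
    have hsub : J ⊆ (Finset.univ.filter fun j =>
        (j ≠ I.shepherd ∧ τ.pos t j = τ.pos t I.shepherd) ∧
        τ.msg t j = some (Message.report true)) := by
      intro j hj
      simp only [Finset.mem_filter, Finset.mem_univ, true_and]
      refine ⟨⟨(mem_followers.1 (hJ hj)).2, ?_⟩, hmsg j (hJ hj) _ (hs' j hj)⟩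
      rcases h j (hJ hj) with h1 | h1
      · exact h1.2.trans hu.symm
      · have := h1.1.symm.trans (hs' j hj); simp at this
    have := hm.trans (Finset.card_le_card hsub)
    rw [← hcount] at this
    exact Nat.lt_of_succ_le this

/-! ### Exploration -/

theorem discovered_subset_nodes (G : PortGraph n) (v : Fin n) (l : List (ℕ × Bool)) :
    ∀ x ∈ G.discovered v l, x ∈ G.nodes v l := by
  induction l generalizing v with
  | nil => intro x hx; simp [PortGraph.discovered] at hx
  | cons a l ih =>
    intro x hx
    rw [PortGraph.nodes_cons]
    rw [PortGraph.discovered, List.mem_append] at hx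
    rcases hx with hx | hx
    · have : x = G.next v a.1 := by
        split_ifs at hx <;> simp_all
      exact List.mem_cons_of_mem _ (this ▸ G.start_mem_nodes _ _)
    · exact List.mem_cons_of_mem _ (ih _ x hx)

/-- The nodes known from the tour `l` from `r`. -/
def known (G : PortGraph n) (r : Fin n) (l : List (ℕ × Bool)) : List (Fin n) :=
  r :: G.discovered r l

/-- The detour returns to where it left the tour, so the rest of the walk is unchanged and exactly
one discovery is added. -/
theorem known_insert_perm (G : PortGraph n) (r : Fin n) {w : Fin n} {A B : List (ℕ × Bool)}
    {p q : ℕ} (hw : G.next (G.dest r B) p = w) (hq : G.next w q = G.dest r B) :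
    (known G r (B ++ (p, true) :: (q, false) :: A)).Perm (w :: known G r (B ++ A)) := by
  have : G.discovered r (B ++ (p, true) :: (q, false) :: A) =
      G.discovered r B ++ w :: G.discovered (G.dest r B) A := by
    simp [PortGraph.discovered_append, PortGraph.discovered, hw, hq]
  rw [known, known, this, G.discovered_append]
  exact (List.perm_middle.cons r).trans (List.Perm.swap _ _ _)

/-- The situation when the shepherd and the herd are at a node `u` of the tour, whose ports below `p`
have been checked. -/
structure Exploring (I : Instance n k) (τ : Trace n k (algorithm W)) (f t : ℕ) (r u : Fin n)
    (A B : List (ℕ × Bool)) (p : ℕ) : Prop where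
  shepherd : ∃ e, ShepherdAt I τ t (.base f A B p) (u, e)
  herd : HerdAt I τ t u {x | x ∈ I.G.sources r B}
  size : HerdSize I τ t (f + 1)
  dest_done : I.G.dest r B = u
  dest_todo : I.G.dest u A = r
  nodup : (known I.G r (B ++ A)).Nodup
  nodes_subset : ∀ x ∈ I.G.nodes r (B ++ A), x ∈ known I.G r (B ++ A)
  length_eq : B.length + A.length + 2 = 2 * (known I.G r (B ++ A)).length
  closed : ∀ x ∈ I.G.sources r B, ∀ j < I.G.deg x, I.G.next x j ∈ known I.G r (B ++ A)
  checked : ∀ j < p, j < I.G.deg u → I.G.next u j ∈ known I.G r (B ++ A)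
  port_le : p ≤ n

/-- The tour has two steps for each known node other than the root, and known nodes are distinct. -/
theorem Exploring.length_le {t p : ℕ} {r u : Fin n} {A B : List (ℕ × Bool)}
    (h : Exploring I τ f t r u A B p) : B.length + A.length + 2 ≤ 2 * n := by
  have := h.nodup.length_le_card
  rw [Fintype.card_fin] at this
  rw [h.length_eq]
  omega

/-- The shepherd looks for the herd before each move, including the final one through `p`, so the
last node of the walk is inspected too. -/
theorem scan_spec (hI : I.Valid f) (hτ : τ.IsExecution I f) {w : Fin n} {D : Set (Fin n)}
    {A B : List (ℕ × Bool)} {p q : ℕ} (rest : List (ℕ × Bool)) :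
    ∀ (t : ℕ) (v : Fin n) (e : Option ℕ) (found : Prop),
    ShepherdAt I τ t (.scan f A B p q rest found) (v, e) → HerdAt I τ t w D →
    HerdSize I τ t (f + 1) →
    ∃ found' : Prop, (found' ↔ found ∨ w ∈ I.G.nodes v rest) ∧
      ShepherdAt I τ (t + rest.length + 1) (.back f A B p q found')
        (I.G.leave (I.G.dest v rest) (some p)) ∧
      HerdAt I τ (t + rest.length + 1) w D ∧ HerdSize I τ (t + rest.length + 1) (f + 1) := by
  induction rest with
  | nil =>
    intro t v e found hs hh hm
    have h1 := hs.next hI hτ (by simp) (by simp [Memory.Done])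
    have h2 := herdHere_iff hI hτ hh hm
    rw [show τ.pos t I.shepherd = v from congrArg Prod.fst hs.2] at h2
    refine ⟨_, ?_, h1, hh.wait hI hτ hs rfl, hm.wait hI hτ hs rfl⟩
    simp [h2, PortGraph.nodes, PortGraph.sources, PortGraph.dest, eq_comm]
  | cons a rest ih =>
    intro t v e found hs hh hm
    have h1 := hs.next hI hτ (by simp) (by simp [Memory.Done])
    have h2 := herdHere_iff hI hτ hh hm
    rw [show τ.pos t I.shepherd = v from congrArg Prod.fst hs.2] at h2
    obtain ⟨found', hf, h3, h4, h5⟩ := ih (t + 1) _ _ _ h1 (hh.wait hI hτ hs rfl)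
      (hm.wait hI hτ hs rfl)
    have ht : t + (a :: rest).length + 1 = t + 1 + rest.length + 1 := by
      simp only [List.length_cons]; omega
    rw [ht]
    refine ⟨found', ?_, h3, h4, h5⟩
    rw [hf, h2, PortGraph.nodes_cons, List.mem_cons, or_assoc, eq_comm (a := w)]
    rfl

/-- The check of a port. -/
theorem Exploring.check (hI : I.Valid f) (hτ : τ.IsExecution I f) {t p : ℕ} {r u : Fin n}
    {A B : List (ℕ × Bool)} (h : Exploring I τ f t r u A B p) (hp : p < I.G.deg u) :
    ∃ A', Exploring I τ f (t + (B.length + A.length) + 4) r u A' B (p + 1) := by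
  classical
  obtain ⟨e, hs⟩ := h.shepherd
  obtain ⟨w, q, hc, hq⟩ := I.G.exists_cross hp
  have hw : I.G.next u p = w := I.G.next_of_cross hc
  have hback : I.G.next w q = u := I.G.next_back hc
  have hport : (Memory.base f A B p).port W (viewAt I (u, e)) = some p := if_pos hp
  have s1 := hs.next hI hτ (by simp) (by simp [Memory.Done])
  have g1 := h.herd.lead hI hτ hs rfl
  have m1 := h.size.lead hI hτ hs h.herd rfl
  rw [hport, I.G.leave_some_of_cross hc] at s1
  rw [hport, I.G.leave_some_of_cross hc] at g1
  rw [show (Memory.base f A B p).update (viewAt I (u, e)) (τ.heard I t I.shepherd) =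
    .away f A B p from if_pos hp] at s1
  have s2 := s1.next hI hτ (by simp) (by simp [Memory.Done])
  have g2 := g1.wait hI hτ s1 rfl
  have m2 := m1.wait hI hτ s1 rfl
  have s2' : ShepherdAt I τ (t + 1 + 1) (.scan f A B p q (A ++ B) False)
      (u, (I.G.leave w (some q)).2) := by
    rw [← hback]; exact s2
  obtain ⟨found, hf, s3, g3, m3⟩ := scan_spec hI hτ (A ++ B) _ _ _ _ s2' g2 m2
  have hdest : I.G.dest u (A ++ B) = u := by rw [I.G.dest_append, h.dest_todo, h.dest_done]
  rw [hdest, I.G.leave_some_of_cross hc] at s3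
  have s4 := s3.next hI hτ (by simp) (by simp [Memory.Done])
  have g4 := g3.lead hI hτ s3 rfl
  have m4 := m3.lead hI hτ s3 g3 rfl
  have ht : t + 1 + 1 + (A ++ B).length + 1 + 1 = t + (B.length + A.length) + 4 := by
    rw [List.length_append]; omega
  rw [ht] at s4 g4 m4
  -- A closed tour has the same nodes wherever it starts.
  have hnodes : ∀ x, x ∈ I.G.nodes u (A ++ B) ↔ x ∈ I.G.nodes r (B ++ A) := by
    intro x
    rw [I.G.mem_nodes_append, I.G.mem_nodes_append, h.dest_todo, h.dest_done, or_comm]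
  have hknown : ∀ x ∈ known I.G r (B ++ A), x ∈ I.G.nodes r (B ++ A) := by
    intro x hx
    rcases List.mem_cons.1 hx with rfl | hx
    · exact I.G.start_mem_nodes _ _
    · exact discovered_subset_nodes _ _ _ _ hx
  rw [hnodes, false_or] at hf
  have hherd : HerdAt I τ (t + (B.length + A.length) + 4) u {x | x ∈ I.G.sources r B} := by
    have g5 : HerdAt I τ (t + (B.length + A.length) + 4) (I.G.next w q)
        (insert w (insert u {x | x ∈ I.G.sources r B})) := g4
    rw [hback] at g5
    exact g5.mono fun x hx => Or.inr (Or.inr hx)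
  have hshep : ∃ e, ShepherdAt I τ (t + (B.length + A.length) + 4)
      (.base f (if found then A else (p, true) :: (q, false) :: A) B (p + 1)) (u, e) := by
    refine ⟨(I.G.leave w (some q)).2, ?_⟩
    have : (u, (I.G.leave w (some q)).2) = I.G.leave w (some q) := Prod.ext hback.symm rfl
    rw [this]
    exact s4
  have hple : p + 1 ≤ n := hp.trans_le (I.G.deg_le u)
  by_cases hfound : found
  · rw [if_pos hfound] at hshep
    refine ⟨A, hshep, hherd, m4, h.dest_done, h.dest_todo, h.nodup, h.nodes_subset, h.length_eq,
      h.closed, fun j hj hj' => ?_, hple⟩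
    rcases Nat.lt_succ_iff_lt_or_eq.1 hj with hj | rfl
    · exact h.checked j hj hj'
    · rw [hw]; exact h.nodes_subset _ (hf.1 hfound)
  · rw [if_neg hfound] at hshep
    have hperm : (known I.G r (B ++ (p, true) :: (q, false) :: A)).Perm
        (w :: known I.G r (B ++ A)) :=
      known_insert_perm I.G r (by rw [h.dest_done, hw]) (by rw [h.dest_done, hback])
    have hmem : ∀ x, x ∈ known I.G r (B ++ A) →
        x ∈ known I.G r (B ++ (p, true) :: (q, false) :: A) :=
      fun x hx => hperm.mem_iff.2 (List.mem_cons_of_mem _ hx)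
    refine ⟨_, hshep, hherd, m4, h.dest_done, ?_, ?_, ?_, ?_, fun x hx j hj =>
      hmem _ (h.closed x hx j hj), fun j hj hj' => ?_, hple⟩
    · simp only [PortGraph.dest, hw, hback, h.dest_todo]
    · rw [hperm.nodup_iff, List.nodup_cons]
      exact ⟨fun hx => hfound (hf.2 (hknown _ hx)), h.nodup⟩
    · intro x hx
      rw [I.G.mem_nodes_append, h.dest_done, I.G.nodes_cons, I.G.nodes_cons] at hx
      simp only [hw, hback, List.mem_cons] at hx
      have hu : u ∈ I.G.nodes r B := h.dest_done ▸ I.G.dest_mem_nodes r B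
      have hold := fun hx => hmem x (h.nodes_subset x ((I.G.mem_nodes_append r x B A).2 hx))
      rw [h.dest_done] at hold
      rcases hx with hx | rfl | rfl | hx
      · exact hold (Or.inl hx)
      · exact hold (Or.inl hu)
      · exact hperm.mem_iff.2 List.mem_cons_self
      · exact hold (Or.inr hx)
    · rw [hperm.length_eq]
      have := h.length_eq
      simp only [List.length_cons]
      omega
    · rcases Nat.lt_succ_iff_lt_or_eq.1 hj with hj | rfl
      · exact hmem _ (h.checked j hj hj')
      · rw [hw]; exact hperm.mem_iff.2 List.mem_cons_self

/-- When all ports of a node are checked, the herd moves on along the tour. -/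
theorem Exploring.advance (hI : I.Valid f) (hτ : τ.IsExecution I f) {t p : ℕ} {r u : Fin n}
    {a : ℕ × Bool} {A B : List (ℕ × Bool)} (h : Exploring I τ f t r u (a :: A) B p)
    (hp : ¬ p < I.G.deg u) :
    Exploring I τ f (t + 1) r (I.G.next u a.1) A (B ++ [a]) 0 := by
  obtain ⟨e, hs⟩ := h.shepherd
  have hport : (Memory.base f (a :: A) B p).port W (viewAt I (u, e)) = some a.1 := if_neg hp
  have s1 := hs.next hI hτ (by simp) (by simp [Memory.Done])
  have g1 := h.herd.lead hI hτ hs rfl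
  have m1 := h.size.lead hI hτ hs h.herd rfl
  rw [hport] at s1 g1
  rw [show (Memory.base f (a :: A) B p).update (viewAt I (u, e)) (τ.heard I t I.shepherd) =
    .base f A (B ++ [a]) 0 from if_neg hp] at s1
  have hsrc : I.G.sources r (B ++ [a]) = I.G.sources r B ++ [u] := by
    rw [I.G.sources_append, h.dest_done]; rfl
  have happ : B ++ [a] ++ A = B ++ a :: A := by simp
  refine ⟨⟨_, s1⟩, g1.mono ?_, m1, ?_, h.dest_todo, ?_, ?_, ?_, ?_, fun j hj => by omega,
    Nat.zero_le _⟩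
  · intro x hx
    change x ∈ I.G.sources r (B ++ [a]) at hx
    rw [hsrc, List.mem_append, List.mem_singleton] at hx
    exact hx.symm
  · rw [I.G.dest_append, h.dest_done]; rfl
  · rw [happ]; exact h.nodup
  · rw [happ]; exact h.nodes_subset
  · rw [happ, ← h.length_eq]; simp only [List.length_append, List.length_cons, List.length_nil]
    omega
  · intro x hx j hj
    rw [happ]
    rw [hsrc, List.mem_append, List.mem_singleton] at hx
    rcases hx with hx | rfl
    · exact h.closed x hx j hj
    -- The node just left had all its ports checked.
    · exact h.checked j (by omega) hj

/-- The situation at the beginning of the settlement: the herd consists of all followers, and the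
tour `T` discovers every node exactly once. -/
structure Assembled (I : Instance n k) (τ : Trace n k (algorithm W)) (t : ℕ) (r : Fin n)
    (L : List ℕ) (T : List (ℕ × Bool)) : Prop where
  shepherd : ∃ e, ShepherdAt I τ t (.settle L T true) (r, e)
  herd : ∀ i ∈ followers I,
    τ.state t i = some (.follower (I.id i) true) ∧ τ.pos t i = r ∧ I.id i ∈ L
  labels : L.length < k
  nodup : (known I.G r T).Nodup
  complete : ∀ v, v ∈ known I.G r T
  length_le : T.length + 2 ≤ 2 * n

/-- Even a Byzantine robot yields only one sighting, and no robot hears itself. -/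
theorem card_heard_lt (t : ℕ) (i : Fin k) : (τ.heard I t i).card < k := by
  rw [Trace.heard, Multiset.card_map, Finset.card_val]
  refine (Finset.card_lt_univ_of_notMem (x := i) (by simp)).trans_eq (Fintype.card_fin k)

/-- When the tour is completed, all nodes are known and all followers have joined the herd. -/
theorem Exploring.finish (hI : I.Valid f) (hτ : τ.IsExecution I f) {t p : ℕ} {r u : Fin n}
    {B : List (ℕ × Bool)} (h : Exploring I τ f t r u [] B p) (hp : ¬ p < I.G.deg u) :
    ∃ L, Assembled I τ (t + 1) r L B := by
  obtain ⟨e, hs⟩ := h.shepherd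
  obtain rfl : u = r := h.dest_todo
  have hport : (Memory.base f [] B p).port W (viewAt I (u, e)) = none := if_neg hp
  have s1 := hs.next hI hτ (by simp) (by simp [Memory.Done])
  rw [hport] at s1
  rw [show (Memory.base f [] B p).update (viewAt I (u, e)) (τ.heard I t I.shepherd) =
    .settle ((τ.heard I t I.shepherd).map Sighting.label).toList B true from if_neg hp] at s1
  have hB : B ++ [] = B := List.append_nil B
  have hsub := h.nodes_subset
  have hnd := h.nodup
  have hclosed := h.closed
  have hchecked := h.checked
  have hlen := h.length_le
  rw [hB] at hsub hnd hclosed hchecked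
  have hnodes : ∀ x ∈ known I.G u B, x ∈ I.G.sources u B ∨ x = u := by
    intro x hx
    rcases List.mem_cons.1 hx with rfl | hx
    · exact Or.inr rfl
    · have := discovered_subset_nodes _ _ _ _ hx
      rwa [PortGraph.nodes, h.dest_done, List.mem_append, List.mem_singleton] at this
  -- Every known node lies on the tour, so its ports have been checked: the known nodes are closed
  -- under moves.
  have hcomplete : ∀ v, v ∈ known I.G u B := by
    refine fun v => I.G.mem_of_closed (S := {x | x ∈ known I.G u B}) (r := u)
      List.mem_cons_self ?_ v
    intro x hx j hj
    rcases hnodes x hx with hx | rfl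
    · exact hclosed x hx j hj
    · exact hchecked j (by omega) hj
  have hpos : ∀ i ∈ followers I, τ.pos t i = u := by
    intro i hi
    rcases h.herd i hi with h1 | ⟨_, h1, h2⟩
    · exact h1.2
    -- A follower not yet in the herd can only have started at the final base, where the last order
    -- reaches it.
    · exact h1.trans ((hnodes _ (hcomplete _)).resolve_left h2)
  refine ⟨_, ⟨_, s1⟩, fun i hi => ?_, ?_, hnd, hcomplete, ?_⟩
  · have h1 := h.herd.obeys hI hτ hs (p := none) (congrArg (Message.order []) hport) hi (hpos i hi)
    refine ⟨h1.1, h1.2, ?_⟩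
    rw [Multiset.mem_toList, Multiset.mem_map]
    refine ⟨_, mem_heard (i := I.shepherd) (mem_followers.1 hi).2 ?_,
      hτ.label_eq t i (mem_followers.1 hi).1⟩
    exact (hpos i hi).trans (congrArg Prod.fst hs.2).symm
  · rw [Multiset.length_toList, Multiset.card_map]
    exact card_heard_lt t _
  · simpa using hlen

/-- The exploration ends in time. -/
theorem Exploring.exists_assembled (hI : I.Valid f) (hτ : τ.IsExecution I f) (m : ℕ) :
    ∀ {t p : ℕ} {r u : Fin n} {A B : List (ℕ × Bool)}, Exploring I τ f t r u A B p →
    (2 * n - 2 - B.length) * (n + 1) + (n - p) ≤ m →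
    ∃ t' ≤ t + m * (2 * n + 2) + 1, ∃ r L T, Assembled I τ t' r L T := by
  -- The potential `(2 * n - 2 - B.length) * (n + 1) + (n - p)` drops with every check and with
  -- every advance, which resets `p` to 0; each of them takes at most `2 * n + 2` rounds.
  induction m with
  | zero =>
    intro t p r u A B h hm
    have hlen := h.length_le
    have hp : ¬ p < I.G.deg u := by
      have := I.G.deg_le u
      omega
    cases A with
    | nil =>
      obtain ⟨L, hL⟩ := h.finish hI hτ hp
      exact ⟨t + 1, by omega, r, L, B, hL⟩
    | cons a A =>
      exfalso
      simp only [List.length_cons] at hlen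
      have : 1 ≤ 2 * n - 2 - B.length := by omega
      have := Nat.mul_le_mul this (le_refl (n + 1))
      omega
  | succ m ih =>
    intro t p r u A B h hm
    have hlen := h.length_le
    have hple := h.port_le
    have hmul : (m + 1) * (2 * n + 2) = m * (2 * n + 2) + (2 * n + 2) := Nat.succ_mul _ _
    by_cases hp : p < I.G.deg u
    · obtain ⟨A', h'⟩ := h.check hI hτ hp
      have := I.G.deg_le u
      obtain ⟨t', ht', hA⟩ := ih h' (by omega)
      exact ⟨t', by omega, hA⟩
    · cases A with
      | nil =>
        obtain ⟨L, hL⟩ := h.finish hI hτ hp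
        exact ⟨t + 1, by omega, r, L, B, hL⟩
      | cons a A =>
        simp only [List.length_cons] at hlen
        have e : 2 * n - 2 - B.length = (2 * n - 2 - (B ++ [a]).length) + 1 := by
          simp only [List.length_append, List.length_cons, List.length_nil]; omega
        rw [e, Nat.succ_mul] at hm
        obtain ⟨t', ht', hA⟩ := ih (h.advance hI hτ hp) (by omega)
        exact ⟨t', by omega, hA⟩

/-! ### Gathering -/

theorem leave_eq_getD (G : PortGraph n) (v : Fin n) (p : ℕ) :
    ((G.leave v (some p)).1, (G.leave v (some p)).2.getD 0) = (G.cross v p).getD (v, 0) := by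
  simp only [PortGraph.leave, Option.bind_some]
  cases G.cross v p <;> rfl

/-- Each robot is a follower, Byzantine or the shepherd. Thus the followers alone reach the
threshold of the gathering. -/
theorem le_card_followers (hI : I.Valid f) : k ≤ (followers I).card + f + 1 := by
  classical
  have h : (Finset.univ : Finset (Fin k)) ⊆ (followers I ∪ I.byz) ∪ {I.shepherd} := by
    intro i _
    simp only [Finset.mem_union, mem_followers, Finset.mem_singleton]
    tauto
  have h1 := Finset.card_le_card h
  have h2 := Finset.card_union_le (followers I ∪ I.byz) {I.shepherd}
  have h3 := Finset.card_union_le (followers I) I.byz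
  have h4 := hI.card_byz
  rw [Finset.card_univ, Fintype.card_fin] at h1
  rw [Finset.card_singleton] at h2
  omega

/-- The situation in round `t` of the gathering. -/
structure Gathering (I : Instance n k) (τ : Trace n k (algorithm W)) (f t : ℕ) : Prop where
  shepherd : ShepherdAt I τ t (.gather k f t) (τ.pos t I.shepherd, τ.entry t I.shepherd)
  herd : HerdAt I τ t (τ.pos t I.shepherd) {x | ∃ s < t, τ.pos s I.shepherd = x}

theorem Gathering.zero (hI : I.Valid f) (hτ : τ.IsExecution I f) : Gathering I τ f 0 := by
  refine ⟨⟨?_, rfl⟩, fun i hi => Or.inr ⟨?_, hτ.pos_zero i, ?_⟩⟩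
  · rw [hτ.state_zero _ hI.shepherd_honest, if_pos rfl]
  · rw [hτ.state_zero _ (mem_followers.1 hi).1, if_neg (mem_followers.1 hi).2]
  · rintro ⟨s, hs, -⟩
    omega

theorem Gathering.move (hI : I.Valid f) (hτ : τ.IsExecution I f) {t : ℕ}
    (h : Gathering I τ f t) :
    (τ.pos (t + 1) I.shepherd, τ.entry (t + 1) I.shepherd) =
      I.G.leave (τ.pos t I.shepherd) (some (gatherPort W t (τ.view I t I.shepherd))) :=
  (h.shepherd.next hI hτ (by simp) (by simp [Memory.Done])).2

theorem Gathering.herd_succ (hI : I.Valid f) (hτ : τ.IsExecution I f) {t : ℕ}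
    (h : Gathering I τ f t) :
    HerdAt I τ (t + 1) (τ.pos (t + 1) I.shepherd) {x | ∃ s < t + 1, τ.pos s I.shepherd = x} := by
  have h1 := h.herd.lead hI hτ h.shepherd rfl
  have h2 : τ.pos (t + 1) I.shepherd = _ := congrArg Prod.fst (h.move hI hτ)
  rw [h2]
  refine HerdAt.mono h1 ?_
  rintro x ⟨s, hs, rfl⟩
  rcases Nat.lt_succ_iff_lt_or_eq.1 hs with hs | rfl
  · exact Or.inr ⟨s, hs, rfl⟩
  · exact Or.inl rfl

theorem Gathering.succ (hI : I.Valid f) (hτ : τ.IsExecution I f) {t : ℕ}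
    (h : Gathering I τ f t) (hk : ¬ k ≤ (τ.heard I t I.shepherd).card + f + 1) :
    Gathering I τ f (t + 1) := by
  have h1 := h.shepherd.next hI hτ (by simp) (by simp [Memory.Done])
  rw [show (Memory.gather k f t).update _ (τ.heard I t I.shepherd) = .gather k f (t + 1)
    from if_neg hk] at h1
  exact ⟨⟨h1.1, rfl⟩, h.herd_succ hI hτ⟩

/-- When enough robots are at the node of the shepherd, more than `f` of them are followers, and the
exploration begins. -/
theorem Gathering.exploring (hI : I.Valid f) (hτ : τ.IsExecution I f) (hf : 3 * f + 2 ≤ k) {t : ℕ}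
    (h : Gathering I τ f t) (hk : k ≤ (τ.heard I t I.shepherd).card + f + 1) :
    Exploring I τ f (t + 1) (τ.pos (t + 1) I.shepherd) (τ.pos (t + 1) I.shepherd) [] [] 0 := by
  classical
  have h1 := h.shepherd.next hI hτ (by simp) (by simp [Memory.Done])
  rw [show (Memory.gather k f t).update _ (τ.heard I t I.shepherd) = .base f [] [] 0
    from if_pos hk] at h1
  have hsize : HerdSize I τ (t + 1) (f + 1) := by
    refine ⟨(followers I).filter fun i => τ.pos t i = τ.pos t I.shepherd, Finset.filter_subset _ _,
      ?_, fun i hi => ?_⟩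
    -- Of at least k - f - 1 robots present at most f are Byzantine, which leaves k - 2f - 1 ≥ f + 1
    -- followers.
    · have hsub : (Finset.univ.filter fun j => j ≠ I.shepherd ∧ τ.pos t j = τ.pos t I.shepherd) ⊆
          ((followers I).filter fun i => τ.pos t i = τ.pos t I.shepherd) ∪ I.byz := by
        intro j hj
        simp only [Finset.mem_filter, Finset.mem_univ, true_and] at hj
        simp only [Finset.mem_union, Finset.mem_filter, mem_followers]
        tauto
      have h2 := (Finset.card_le_card hsub).trans (Finset.card_union_le _ _)
      have h3 := hI.card_byz
      rw [Trace.heard, Multiset.card_map, Finset.card_val] at hk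
      omega
    · rw [Finset.mem_filter] at hi
      exact (h.herd.obeys hI hτ h.shepherd rfl hi.1 hi.2).1
  refine ⟨⟨τ.entry (t + 1) I.shepherd, h1.1, rfl⟩, (h.herd_succ hI hτ).mono ?_, hsize, rfl, rfl,
    ?_, ?_, ?_, ?_, ?_, Nat.zero_le _⟩
  · intro x hx
    exact absurd hx List.not_mem_nil
  · simp [known, PortGraph.discovered]
  · simp [known, PortGraph.discovered, PortGraph.nodes, PortGraph.sources, PortGraph.dest]
  · simp [known, PortGraph.discovered]
  · intro x hx
    exact absurd hx List.not_mem_nil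
  · intro j hj
    omega

/-- The phase with budget `2 ^ j` visits all nodes if its sequence is universal. -/
theorem Gathering.exists_pos_eq (hI : I.Valid f) (hτ : τ.IsExecution I f) {j : ℕ}
    (hW : IsUXS n (W j)) (hl : uxsRounds (W j) ≤ 2 ^ j)
    (h : ∀ t < 2 ^ (j + 1), Gathering I τ f t) (v : Fin n) :
    ∃ t < 2 ^ (j + 1), τ.pos t I.shepherd = v := by
  have hj : 0 < 2 ^ j := by positivity
  have hj2 : 2 ^ (j + 1) = 2 ^ j + 2 ^ j := by ring
  obtain ⟨t₀, ht₀⟩ : ∃ t₀, 2 ^ j = t₀ + 1 := ⟨2 ^ j - 1, by omega⟩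
  -- At the beginning of a phase the actual entry port is replaced by the fictitious port 0 from
  -- which the sequence `0 :: W j` starts.
  let b : ℕ → Fin n × ℕ := fun s =>
    (τ.pos (t₀ + s) I.shepherd, if s = 0 then 0 else (τ.entry (t₀ + s) I.shepherd).getD 0)
  have hb : ∀ s < (0 :: W j).length, b (s + 1) = (I.G.cross (b s).1
      (((b s).2 + (0 :: W j).getD s 0) % (I.G.deg (b s).1 : ℤ)).toNat).getD ((b s).1, 0) := by
    intro s hs
    rw [List.length_cons] at hs
    rw [uxsRounds] at hl
    have hlog : Nat.log 2 (t₀ + s + 1) = j :=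
      Nat.log_eq_of_pow_le_of_lt_pow (by omega) (by omega)
    have hmove := (h (t₀ + s) (by omega)).move hI hτ
    have hport : gatherPort W (t₀ + s) (τ.view I (t₀ + s) I.shepherd) =
        (((b s).2 + (0 :: W j).getD s 0) % (I.G.deg (b s).1 : ℤ)).toNat := by
      simp only [gatherPort, hlog]
      cases s with
      | zero => rw [if_pos (by omega)]; simp [b]
      | succ s =>
        rw [if_neg (by omega), show t₀ + (s + 1) - 2 ^ j = s by omega]
        rfl
    rw [hport] at hmove
    rw [← leave_eq_getD, ← hmove]
    rfl
  obtain ⟨s, hs, hv⟩ := I.G.exists_eq_of_mem_visits v (0 :: W j) b hb (hW n le_rfl I.G _ v)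
  refine ⟨t₀ + s, ?_, hv⟩
  rw [List.length_cons] at hs
  rw [uxsRounds] at hl
  omega

/-- The gathering ends in time. -/
theorem exists_exploring (hI : I.Valid f) (hτ : τ.IsExecution I f) (hf : 3 * f + 2 ≤ k) {j : ℕ}
    (hW : IsUXS n (W j)) (hl : uxsRounds (W j) ≤ 2 ^ j) :
    ∃ t ≤ 2 ^ (j + 1), ∃ u, Exploring I τ f t u u [] [] 0 := by
  by_contra hcon
  have hstep : ∀ t < 2 ^ (j + 1), Gathering I τ f t →
      ¬ k ≤ (τ.heard I t I.shepherd).card + f + 1 :=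
    fun t ht hg hk => hcon ⟨t + 1, ht, _, hg.exploring hI hτ hf hk⟩
  have hg : ∀ t < 2 ^ (j + 1), Gathering I τ f t := by
    intro t
    induction t with
    | zero => exact fun _ => Gathering.zero hI hτ
    | succ t ih =>
      intro ht
      have := ih (by omega)
      exact this.succ hI hτ (hstep t (by omega) this)
  obtain ⟨t, ht⟩ : ∃ t, 2 ^ (j + 1) = t + 1 :=
    ⟨2 ^ (j + 1) - 1, by have : 0 < 2 ^ (j + 1) := by positivity
                         omega⟩
  have hgt := hg t (by omega)
  refine hstep t (by omega) hgt ((le_card_followers hI).trans ?_)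
  have hsub : followers I ⊆
      Finset.univ.filter fun j => j ≠ I.shepherd ∧ τ.pos t j = τ.pos t I.shepherd := by
    intro i hi
    simp only [Finset.mem_filter, Finset.mem_univ, true_and]
    refine ⟨(mem_followers.1 hi).2, ?_⟩
    rcases hgt.herd i hi with h1 | ⟨_, h1, h2⟩
    · exact h1.2
    · obtain ⟨s, hs, hs'⟩ := Gathering.exists_pos_eq hI hτ hW hl hg (I.start i)
      rcases Nat.lt_succ_iff_lt_or_eq.1 (ht ▸ hs) with hs | rfl
      · exact absurd ⟨s, hs, hs'⟩ h2
      -- A start node first reached at time `t` itself has received no order, but its follower is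
      -- already with the shepherd.
      · exact h1.trans hs'.symm
  have := Finset.card_le_card hsub
  rw [Trace.heard, Multiset.card_map, Finset.card_val]
  omega

/-! ### Settlement -/

/-- The discovered nodes of a tour that has entered `v`, as a new node or not. -/
def toSettle (G : PortGraph n) (v : Fin n) (new : Bool) (T : List (ℕ × Bool)) : List (Fin n) :=
  (if new then [v] else []) ++ G.discovered v T

/-- The situation when the shepherd leads the remaining herd along the rest `T` of the tour. -/
structure Settling (I : Instance n k) (τ : Trace n k (algorithm W)) (t : ℕ) (v : Fin n)
    (L : List ℕ) (T : List (ℕ × Bool)) (new : Bool) : Prop where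
  shepherd : ∃ e, ShepherdAt I τ t (.settle L T new) (v, e)
  herd : ∀ i ∈ followers I,
    (τ.state t i = some (.follower (I.id i) true) ∧ τ.pos t i = v ∧ I.id i ∈ L) ∨
    (τ.state t i = none ∧ τ.pos t i ∉ toSettle I.G v new T)
  settled : ∀ x, ((followers I).filter fun i => τ.state t i = none ∧ τ.pos t i = x).card ≤ I.cap x
  nodup : (toSettle I.G v new T).Nodup
  room : L.length < ((toSettle I.G v new T).map I.cap).sum

theorem ShepherdAt.terminate (hI : I.Valid f) (hτ : τ.IsExecution I f) {t : ℕ} {s : Memory}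
    {a : Fin n × Option ℕ} (h : ShepherdAt I τ t s a) (hd : s.Done (viewAt I a)) :
    τ.state (t + 1) I.shepherd = none ∧ τ.pos (t + 1) I.shepherd = a.1 := by
  have h1 := hτ.follow t _ hI.shepherd_honest
  have h2 : decision W s (viewAt I a) (τ.heard I t I.shepherd) = .terminate := by
    cases s <;> first | exact absurd hd id | exact if_pos hd
  have h3 : τ.next I t I.shepherd = Trace.outcome I.G a.1 .terminate := by
    have h0 := h.1
    simp only [Trace.next, h0, h.view]
    rw [← h2, ← h.2]
  rw [h3] at h1
  exact ⟨congrArg Prod.fst h1, congrArg (fun x => x.2.1) h1⟩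

/-- Honest IDs are distinct, so forged or repeated entries of the list can only lower the number of
robots that settle. -/
theorem card_id_mem_le (hI : I.Valid f) (S : List ℕ) :
    ((followers I).filter fun i => I.id i ∈ S).card ≤ S.length := by
  refine (Finset.card_le_card_of_injOn (t := S.toFinset) I.id ?_
    hI.id_injective.injOn).trans (List.toFinset_card_le S)
  intro i hi
  have := (Finset.mem_filter.1 (Finset.mem_coe.1 hi)).2
  simpa using this

/-- The last robots and the shepherd settle at a node. -/
theorem Settling.finish (hI : I.Valid f) (hτ : τ.IsExecution I f) {t : ℕ} {v : Fin n} {L : List ℕ}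
    {T : List (ℕ × Bool)} (h : Settling I τ t v L T true) (hL : L.length < I.cap v) :
    τ.DispersedAt I (t + 1) := by
  classical
  obtain ⟨e, hs⟩ := h.shepherd
  have hterm := hs.terminate hI hτ ⟨rfl, hL⟩
  have htake : L.take (I.cap v) = L := List.take_of_length_le hL.le
  have hmsg := hs.msg hI hτ
  have hpos : τ.pos t I.shepherd = v := congrArg Prod.fst hs.2
  have hv : v ∈ toSettle I.G v true T := by simp [toSettle]
  have hfol : ∀ i ∈ followers I, τ.state (t + 1) i = none ∧ τ.pos (t + 1) i = τ.pos t i ∧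
      (τ.pos t i = v ∧ I.id i ∈ L ∨ τ.state t i = none ∧ τ.pos t i ≠ v) := by
    intro i hi
    have hi' := mem_followers.1 hi
    rcases h.herd i hi with ⟨h1, h2, h3⟩ | ⟨h1, h2⟩
    · have h4 := (follower_obeys hτ hi'.1 hi'.2 h1 (h2.trans hpos.symm) hmsg).1
        (by change I.id i ∈ L.take (I.cap v); rwa [htake])
      exact ⟨h4.1, h4.2, Or.inl ⟨h2, h3⟩⟩
    · have h4 := terminated_stays hτ hi'.1 h1
      exact ⟨h4.1, h4.2, Or.inr ⟨h1, fun h => h2 (h ▸ hv)⟩⟩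
  refine ⟨fun i hi => ?_, fun x => ?_⟩
  · by_cases his : i = I.shepherd
    · rw [his]; exact hterm.1
    · exact (hfol i (mem_followers.2 ⟨hi, his⟩)).1
  · by_cases hx : x = v
    · subst hx
      refine (Finset.card_le_card (t := insert I.shepherd
        ((followers I).filter fun i => I.id i ∈ L)) ?_).trans
        ((Finset.card_insert_le _ _).trans
          ((Nat.succ_le_succ (card_id_mem_le hI L)).trans hL))
      intro i hi
      simp only [Finset.mem_filter, Finset.mem_univ, true_and] at hi
      rw [Finset.mem_insert]
      by_cases his : i = I.shepherd
      · exact Or.inl his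
      · have hif := mem_followers.2 ⟨hi.1, his⟩
        obtain ⟨_, h2, h3 | h3⟩ := hfol i hif
        · exact Or.inr (Finset.mem_filter.2 ⟨hif, h3.2⟩)
        · exact absurd (h2.symm.trans hi.2) h3.2
    · refine (Finset.card_le_card ?_).trans (h.settled x)
      intro i hi
      simp only [Finset.mem_filter, Finset.mem_univ, true_and] at hi
      have his : i ≠ I.shepherd := by
        rintro rfl
        exact hx (hi.2.symm.trans hterm.2)
      have hif := mem_followers.2 ⟨hi.1, his⟩
      obtain ⟨_, h2, h3 | h3⟩ := hfol i hif
      · exact absurd (hi.2.symm.trans (h2.trans h3.1)) hx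
      · exact Finset.mem_filter.2 ⟨hif, h3.1, h2.symm.trans hi.2⟩

/-- Some robots settle at a node if it is new, and the others move on. -/
theorem Settling.advance (hI : I.Valid f) (hτ : τ.IsExecution I f) {t : ℕ} {v : Fin n} {L : List ℕ}
    {a : ℕ × Bool} {T : List (ℕ × Bool)} {new : Bool} (h : Settling I τ t v L (a :: T) new)
    (hL : ¬ (new = true ∧ L.length < I.cap v)) :
    ∃ L', Settling I τ (t + 1) (I.G.next v a.1) L' T a.2 := by
  classical
  obtain ⟨e, hs⟩ := h.shepherd
  have s1 := hs.next hI hτ (by simp) hL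
  have hmsg := hs.msg hI hτ
  have hpos : τ.pos t I.shepherd = v := congrArg Prod.fst hs.2
  set S : List ℕ := if new then L.take (I.cap v) else [] with hS
  set L' : List ℕ := if new then L.drop (I.cap v) else L with hL'
  have hSL : ∀ x ∈ L, x ∈ S ∨ x ∈ L' := by
    intro x hx
    cases new
    · exact Or.inr hx
    · simp only [hS, hL', if_true]
      rw [← List.mem_append, List.take_append_drop]
      exact hx
  have htodo : toSettle I.G v new (a :: T) =
      (if new then [v] else []) ++ toSettle I.G (I.G.next v a.1) a.2 T := rfl
  have hnodup := h.nodup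
  have hroom := h.room
  rw [htodo] at hnodup hroom
  have hsub : ∀ x, x ∈ toSettle I.G (I.G.next v a.1) a.2 T → x ∈ toSettle I.G v new (a :: T) :=
    fun x hx => by rw [htodo]; exact List.mem_append_right _ hx
  have hfol : ∀ i ∈ followers I,
      (τ.state (t + 1) i = some (.follower (I.id i) true) ∧ τ.pos (t + 1) i = I.G.next v a.1 ∧
        I.id i ∈ L') ∨
      (τ.state (t + 1) i = none ∧ τ.pos (t + 1) i = v ∧ I.id i ∈ S) ∨
      (τ.state (t + 1) i = none ∧ τ.state t i = none ∧ τ.pos (t + 1) i = τ.pos t i ∧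
        τ.pos t i ∉ toSettle I.G v new (a :: T)) := by
    intro i hi
    have hi' := mem_followers.1 hi
    rcases h.herd i hi with ⟨h1, h2, h3⟩ | ⟨h1, h2⟩
    · have h4 := follower_obeys hτ hi'.1 hi'.2 h1 (h2.trans hpos.symm) hmsg
      by_cases h5 : I.id i ∈ S
      · have h6 := h4.1 h5
        exact Or.inr (Or.inl ⟨h6.1, h6.2.trans h2, h5⟩)
      · have h6 := h4.2 h5
        rw [h2] at h6
        exact Or.inl ⟨h6.1, h6.2, (hSL _ h3).resolve_left h5⟩
    · have h4 := terminated_stays hτ hi'.1 h1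
      exact Or.inr (Or.inr ⟨h4.1, h1, h4.2, h2⟩)
  refine ⟨L', ⟨_, s1⟩, fun i hi => ?_, fun x => ?_, hnodup.of_append_right, ?_⟩
  · rcases hfol i hi with h1 | ⟨h1, h2, h3⟩ | ⟨h1, _, h2, h3⟩
    · exact Or.inl h1
    · refine Or.inr ⟨h1, ?_⟩
      cases new
      · simp [hS] at h3
      · rw [h2]
        exact (List.nodup_cons.1 hnodup).1
    · exact Or.inr ⟨h1, fun h => h3 (hsub _ (h2 ▸ h))⟩
  · by_cases hx : new = true ∧ x = v
    · obtain ⟨rfl, rfl⟩ := hx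
      have hlen : S.length ≤ I.cap x := by simp [hS]
      refine (Finset.card_le_card ?_).trans ((card_id_mem_le hI S).trans hlen)
      intro i hi
      rw [Finset.mem_filter] at hi
      rcases hfol i hi.1 with h1 | h1 | h1
      · have := h1.1.symm.trans hi.2.1; simp at this
      · exact Finset.mem_filter.2 ⟨hi.1, h1.2.2⟩
      · refine absurd ?_ h1.2.2.2
        rw [← h1.2.2.1, hi.2.2]
        simp [toSettle]
    -- Unless `x` is the present node and new, no robot settles there in this round.
    · refine (Finset.card_le_card ?_).trans (h.settled x)
      intro i hi
      rw [Finset.mem_filter] at hi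
      rcases hfol i hi.1 with h1 | h1 | h1
      · have := h1.1.symm.trans hi.2.1; simp at this
      · have h2 : x = v := hi.2.2.symm.trans h1.2.1
        cases new
        · simp [hS] at h1
        · exact absurd ⟨rfl, h2⟩ hx
      · exact Finset.mem_filter.2 ⟨hi.1, h1.2.1, h1.2.2.1.symm.trans hi.2.2⟩
  · cases new
    · simpa [hL'] using hroom
    -- The node is filled completely, so list and remaining capacity shrink by the same amount.
    · have : ¬ L.length < I.cap v := fun h => hL ⟨rfl, h⟩
      simp only [if_true, List.map_append, List.map_cons, List.map_nil, List.sum_append,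
        List.sum_cons, List.sum_nil] at hroom
      simp only [hL', if_true, List.length_drop]
      omega

theorem Settling.exists_dispersedAt (hI : I.Valid f) (hτ : τ.IsExecution I f)
    (T : List (ℕ × Bool)) : ∀ {t : ℕ} {v : Fin n} {L : List ℕ} {new : Bool},
    Settling I τ t v L T new → ∃ t' ≤ t + T.length + 1, τ.DispersedAt I t' := by
  induction T with
  | nil =>
    intro t v L new h
    have hroom := h.room
    cases new
    -- With no node left to settle the room would be 0, which is impossible.
    · simp [toSettle, PortGraph.discovered] at hroom
    · exact ⟨t + 1, by simp, h.finish hI hτ (by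
        simpa [toSettle, PortGraph.discovered] using hroom)⟩
  | cons a T ih =>
    intro t v L new h
    by_cases hL : new = true ∧ L.length < I.cap v
    · obtain ⟨rfl, hL⟩ := hL
      exact ⟨t + 1, by omega, h.finish hI hτ hL⟩
    · obtain ⟨L', h'⟩ := h.advance hI hτ hL
      obtain ⟨t', ht', hd⟩ := ih h'
      exact ⟨t', by simp only [List.length_cons]; omega, hd⟩

theorem Assembled.settling (hI : I.Valid f) {t : ℕ} {r : Fin n} {L : List ℕ} {T : List (ℕ × Bool)}
    (h : Assembled I τ t r L T) : Settling I τ t r L T true := by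
  refine ⟨h.shepherd, fun i hi => Or.inl (h.herd i hi), fun x => ?_, h.nodup, ?_⟩
  · rw [Finset.card_eq_zero.2]
    · exact Nat.zero_le _
    · rw [Finset.filter_eq_empty_iff]
      rintro i hi ⟨h1, -⟩
      have := (h.herd i hi).1.symm.trans h1
      simp at this
  -- The tour discovers each node once, so its room is the total capacity, at least `k` and thus
  -- more than the length of the list.
  · have h1 : ((known I.G r T).map I.cap).sum = ∑ v, I.cap v := by
      rw [← List.sum_toFinset _ h.nodup]
      congr 1
      ext v
      simp [h.complete v]
    exact h.labels.trans_le (hI.total_cap.trans_eq h1.symm)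

/-! ### The whole algorithm -/

theorem solves {j : ℕ} (hf : 3 * f + 2 ≤ k) (hW : IsUXS n (W j)) (hl : uxsRounds (W j) ≤ 2 ^ j) :
    (algorithm W).SolvesByzantineDispersion n k f (2 ^ (j + 1) + 16 * n ^ 3) := by
  intro I hI τ hτ
  obtain ⟨t₁, ht₁, u, h₁⟩ := exists_exploring hI hτ hf hW hl
  obtain ⟨t₂, ht₂, r, L, T, h₂⟩ := h₁.exists_assembled hI hτ _ le_rfl
  obtain ⟨t₃, ht₃, h₃⟩ := (h₂.settling hI).exists_dispersedAt hI hτ T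
  refine ⟨t₃, ?_, h₃⟩
  have hT := h₂.length_le
  obtain ⟨m, rfl⟩ : ∃ m, n = m + 1 := ⟨n - 1, by have := u.pos; omega⟩
  have e : 2 * (m + 1) - 2 - ([] : List (ℕ × Bool)).length = 2 * m := by
    simp only [List.length_nil]; omega
  rw [e, Nat.sub_zero] at ht₂
  -- The initial potential times the cost of a move, one round to begin the settlement, and the
  -- final tour with one more round.
  have hm : (2 * m * (m + 1 + 1) + (m + 1)) * (2 * (m + 1) + 2) + 1 + (2 * m + 1) ≤
      16 * (m + 1) ^ 3 := by
    nlinarith [Nat.zero_le (m ^ 3), Nat.zero_le (m ^ 2), Nat.zero_le m]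
  omega

end Herding

theorem theorem2 :
    ∃ C : ℕ, ∀ U : ℕ → List ℤ, (∀ n, IsUXS n (U n)) →
      ∃ A : Algorithm, ∀ n k f : ℕ, (f : ℝ) < ((k : ℝ) - 1) / 3 →
        A.SolvesByzantineDispersion n k f (C * (uxsRounds (U n) + n ^ 3)) := by
  -- The cubic term of `Herding.solves` needs 16; the gathering takes `2 ^ (j + 1) ≤ 4 * uxsRounds
  -- (U n)` rounds.
  refine ⟨16, fun U hU => ?_⟩
  choose W hW using fun j => exists_budget_uxs hU (2 ^ j)
  refine ⟨Herding.algorithm W, fun n k f hf => ?_⟩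
  have hf' : 3 * f + 2 ≤ k := by
    have h : (3 * f + 1 : ℝ) < k := by linarith
    exact_mod_cast h
  obtain ⟨j, hj, hj'⟩ : ∃ j, uxsRounds (U n) ≤ 2 ^ j ∧ 2 ^ j ≤ 2 * uxsRounds (U n) := by
    have hpos : uxsRounds (U n) ≠ 0 := Nat.succ_ne_zero _
    refine ⟨Nat.log 2 (uxsRounds (U n)) + 1, (Nat.lt_pow_succ_log_self one_lt_two _).le, ?_⟩
    rw [pow_succ, mul_comm]
    exact Nat.mul_le_mul_left _ (Nat.pow_log_le_self 2 hpos)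
  intro I hI τ hτ
  obtain ⟨t, ht, hd⟩ := Herding.solves hf' (hW j n hj).1 (hW j n hj).2 I hI τ hτ
  refine ⟨t, ht.trans ?_, hd⟩
  rw [pow_succ]
  omega
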